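/- Let $M$ be a closed smooth manifold of dimension $n\ge 0$ (compact, Hausdorff, without boundary, not necessarily connected). An open ball in $M$ is an open subset of $M$ that is diffeomorphic to $\mathbb{R}^n$. For $A\subset M$ let $B_M A\in\mathbb{N}\cup\{0,\infty\}$ be the minimal number of open balls in $M$ needed to cover $A$ (so $B_M\emptyset=0$), and put $B(M)=B_M M$. Let $\operatorname{Crit} M\in\mathbb{N}\cup\{0,\infty\}$ be the minimal number of critical points of a smooth function $M\to\mathbb{R}$. Then $B_M A$ is finite for every $A\subset M$. Let $f\colon M\to\mathbb{R}$ be a smooth ($C^\infty$) function with set of critical points $K=\{x\in M \mid df(x)=0\}$, and write $f^c=\{x\in M\mid f(x)\le c\}$ for $c\in\mathbb{R}$. Then for all real numbers $a<b$ $$\sum_{d\in\,]a,b]} B_M\bigl(K\cap f^{-1}(d)\bigr)\ \ge\ B_M f^b-B_M f^a ,$$ where the sum takes values in $\mathbb{N}\cup\{0,\infty\}$. In particular, $\operatorname{Crit} M\ge B(M)$. -/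

import Mathlib

open Set TopologicalSpace
open scoped Manifold ContDiff

/-- An open subset `U` of a smooth `n`-manifold `M` (with the induced smooth structure) is an
open ball if it is diffeomorphic to `ℝⁿ`. -/
def IsOpenBall {n : ℕ} {M : Type*} [TopologicalSpace M]
    [ChartedSpace (EuclideanSpace ℝ (Fin n)) M] (U : Opens M) : Prop :=
  Nonempty (U ≃ₘ^∞⟮𝓡 n, 𝓡 n⟯ EuclideanSpace ℝ (Fin n))

/-- `A ⊆ M` can be covered by `k` open balls of `M`. -/
def CoveredByBalls (n : ℕ) {M : Type*} [TopologicalSpace M]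
    [ChartedSpace (EuclideanSpace ℝ (Fin n)) M] (A : Set M) (k : ℕ) : Prop :=
  ∃ U : Fin k → Opens M, (∀ i, IsOpenBall (n := n) (U i)) ∧ A ⊆ ⋃ i, (U i : Set M)

/-- `B_M A`: the minimal number of open balls of `M` needed to cover `A ⊆ M`;
it is `⊤` if no finite number suffices. -/
noncomputable def ballNumber (n : ℕ) {M : Type*} [TopologicalSpace M]
    [ChartedSpace (EuclideanSpace ℝ (Fin n)) M] (A : Set M) : ℕ∞ :=
  ⨅ (k : ℕ) (_ : CoveredByBalls n A k), (k : ℕ∞)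

/-- The set of critical points of a function `f : M → ℝ` (used for smooth `f` only). -/
def criticalSet (n : ℕ) {M : Type*} [TopologicalSpace M]
    [ChartedSpace (EuclideanSpace ℝ (Fin n)) M] (f : M → ℝ) : Set M :=
  {x | mfderiv (𝓡 n) 𝓘(ℝ, ℝ) f x = 0}

/-- `Crit M`: the minimal number of critical points of a smooth function on `M`;
it is `⊤` if every smooth function has infinitely many critical points. -/
noncomputable def critNumber (n : ℕ) (M : Type*) [TopologicalSpace M]
    [ChartedSpace (EuclideanSpace ℝ (Fin n)) M] : ℕ∞ :=
  ⨅ (f : M → ℝ) (_ : ContMDiff (𝓡 n) 𝓘(ℝ, ℝ) ∞ f), (criticalSet n f).encard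

/-- The sublevel set `f^a`. -/
def sublevel {M : Type*} (f : M → ℝ) (a : ℝ) : Set M :=
  {x | f x ≤ a}

/-! The ball number of `sublevel f c` is monotone in `c`, and its jumps are controlled locally. It
does not jump to the right of a level: an open cover of a compact sublevel set also covers slightly
higher ones (`exists_forall_lt_ballNumber_sublevel_le`). At a level `d`, cover the critical points
on it by balls with union `W`. What remains of the level is compact and regular, so some
diffeomorphism pushes `sublevel f d \ W` below a level `c < d`. Preimages of balls are balls, so the
jump is at most the ball number of the critical points at `d`
(`exists_forall_gt_ballNumber_sublevel_le`). A supremum argument on `[a, b]` combines both facts and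
uses only finitely many levels.

No gradient flow is needed: the diffeomorphism is a finite composite of small pushes supported in
charts, each fixing a point or strictly lowering `f` there. -/

/-! ### Pushing along a vector in a Euclidean space -/

section EuclideanPush

variable {E : Type*} [NormedAddCommGroup E] [NormedSpace ℝ E] [CompleteSpace E]

/-- A smooth perturbation of the identity with Lipschitz constant at most `1 / 2` is a
diffeomorphism. -/
theorem exists_homeomorph_id_add {h : E → E} (hs : ContDiff ℝ ∞ h)
    (hl : LipschitzWith (1 / 2) h) :
    ∃ φ : E ≃ₜ E, (∀ y, φ y = y + h y) ∧ ContDiff ℝ ∞ φ ∧ ContDiff ℝ ∞ φ.symm := by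
  have happ : ApproximatesLinearOn (fun y => y + h y)
      ((ContinuousLinearEquiv.refl ℝ E : E ≃L[ℝ] E) : E →L[ℝ] E) univ (1 / 2) := by
    intro x _ y _
    have := hl.dist_le_mul x y
    rw [dist_eq_norm, dist_eq_norm] at this
    simpa [add_sub_add_comm] using this
  -- The identity has norm 1 only on a nontrivial space, so dimension 0 is separate.
  have hc : Subsingleton E ∨
      (1 / 2 : NNReal) <
        ‖((ContinuousLinearEquiv.refl ℝ E).symm : E →L[ℝ] E)‖₊⁻¹ := by
    rcases subsingleton_or_nontrivial E with hE | hE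
    · exact Or.inl hE
    · right
      have : ‖((ContinuousLinearEquiv.refl ℝ E).symm : E →L[ℝ] E)‖₊ = 1 := by
        simp
      rw [this, inv_one]
      exact NNReal.half_lt_self one_ne_zero
  let φ := happ.toHomeomorph _ hc
  have hφ : ∀ y, φ y = y + h y := fun y => rfl
  have hφs : ContDiff ℝ ∞ φ := contDiff_id.add hs
  -- By the Neumann series the derivative `1 - (-Dh)` is invertible everywhere, so the inverse is
  -- smooth.
  have hnorm : ∀ y, ‖-fderiv ℝ h y‖ < 1 := fun y => by
    rw [norm_neg]
    refine (norm_fderiv_le_of_lipschitz ℝ hl).trans_lt ?_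
    norm_num
  refine ⟨φ, hφ, hφs, φ.contDiff_symm (f₀' := fun y =>
    ContinuousLinearEquiv.unitsEquiv ℝ E (Units.oneSub _ (hnorm y))) (fun y => ?_) hφs⟩
  have h1 : HasFDerivAt (fun y => y + h y) (ContinuousLinearMap.id ℝ E + fderiv ℝ h y) y :=
    (hasFDerivAt_id y).add ((hs.differentiable (by simp)) y).hasFDerivAt
  refine h1.congr_fderiv ?_
  change (1 + fderiv ℝ h y : E →L[ℝ] E) = 1 - -fderiv ℝ h y
  rw [sub_neg_eq_add]

/-- Near a regular point `q` of `g` there is a compactly supported diffeomorphism which strictly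
decreases `g` at every point that it moves, and which moves `q`. -/
theorem exists_homeomorph_decreasing [FiniteDimensional ℝ E] [HasContDiffBump E]
    {g : E → ℝ} {T : Set E} (hT : IsOpen T) {q : E} (hq : q ∈ T)
    (hg : ContDiffOn ℝ ∞ g T) (hd : fderiv ℝ g q ≠ 0) :
    ∃ φ : E ≃ₜ E, ∃ K ⊆ T, IsCompact K ∧ ContDiff ℝ ∞ φ ∧ ContDiff ℝ ∞ φ.symm ∧
      (∀ y ∉ K, φ y = y) ∧ (∀ y, φ y = y ∨ g (φ y) < g y) ∧ g (φ q) < g q := by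
  obtain ⟨v, hv⟩ : ∃ v, fderiv ℝ g q v < 0 := by
    obtain ⟨w, hw⟩ := DFunLike.ne_iff.1 hd
    rcases lt_or_gt_of_ne hw with h | h
    · exact ⟨w, h⟩
    · exact ⟨-w, by simpa using h⟩
  have hcont : ContinuousOn (fun y => fderiv ℝ g y v) T :=
    (hg.continuousOn_fderiv_of_isOpen hT (by simp)).clm_apply continuousOn_const
  obtain ⟨r, hr, hball⟩ : ∃ r > 0, Metric.ball q r ⊆ T ∩ {y | fderiv ℝ g y v < 0} := by
    refine Metric.mem_nhds_iff.1 (Filter.inter_mem (hT.mem_nhds hq) ?_)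
    exact (hcont.continuousAt (hT.mem_nhds hq)).eventually (gt_mem_nhds hv)
  let χ : ContDiffBump q := ⟨r / 4, r / 2, by linarith, by linarith⟩
  obtain ⟨C, hC⟩ := χ.contDiff (n := 1) |>.lipschitzWith_of_hasCompactSupport
    χ.hasCompactSupport one_ne_zero
  -- The first bound makes the perturbation `1/2`-Lipschitz; the second keeps points of the ball of
  -- radius `r / 2` inside the ball of radius `r`.
  obtain ⟨t, ⟨ht1, ht2⟩, ht⟩ : ∃ t : ℝ, (t * (C * ‖v‖) < 1 / 2 ∧ t * ‖v‖ < r / 2) ∧ 0 < t := by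
    have e1 : ∀ᶠ t : ℝ in nhds 0, t * (C * ‖v‖) < 1 / 2 :=
      (Continuous.tendsto' (by fun_prop) 0 0 (by simp)).eventually (gt_mem_nhds (by norm_num))
    have e2 : ∀ᶠ t : ℝ in nhds 0, t * ‖v‖ < r / 2 :=
      (Continuous.tendsto' (by fun_prop) 0 0 (by simp)).eventually (gt_mem_nhds (by linarith))
    exact (((e1.and e2).filter_mono nhdsWithin_le_nhds).and
      (self_mem_nhdsWithin : Ioi (0 : ℝ) ∈ nhdsWithin 0 (Ioi 0))).exists
  have hl : LipschitzWith (1 / 2) (fun y => (t * χ y) • v) := by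
    refine LipschitzWith.of_dist_le_mul fun x y => ?_
    rw [dist_eq_norm, ← sub_smul, ← mul_sub, norm_smul, norm_mul, Real.norm_of_nonneg ht.le,
      ← dist_eq_norm]
    have h1 := hC.dist_le_mul x y
    have h2 : t * dist (χ x) (χ y) * ‖v‖ ≤ t * (C * dist x y) * ‖v‖ := by gcongr
    have h3 : t * (C * ‖v‖) * dist x y ≤ 1 / 2 * dist x y := by gcongr
    push_cast
    linarith
  obtain ⟨φ, hφ, hφs, hφs'⟩ := exists_homeomorph_id_add
    (h := fun y => (t * χ y) • v) ((contDiff_const.mul χ.contDiff).smul contDiff_const) hl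
  have hzero : ∀ y ∉ Metric.closedBall q (r / 2), χ y = 0 := fun y hy =>
    χ.zero_of_le_dist (not_le.1 hy).le
  have hdec : ∀ y, χ y ≠ 0 → g (φ y) < g y := by
    intro y hy
    have hyb : y ∈ Metric.closedBall q (r / 2) := by
      by_contra h
      exact hy (hzero y h)
    have hyr : y ∈ Metric.ball q r := Metric.closedBall_subset_ball (by linarith) hyb
    have hpos : 0 < t * χ y := mul_pos ht (lt_of_le_of_ne χ.nonneg hy.symm)
    have hφr : φ y ∈ Metric.ball q r := by
      rw [Metric.mem_ball, hφ]
      have h1 : dist (y + (t * χ y) • v) y ≤ t * ‖v‖ := by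
        rw [dist_eq_norm, add_sub_cancel_left, norm_smul, Real.norm_of_nonneg hpos.le]
        have := χ.le_one (x := y)
        gcongr
        nlinarith
      have h2 := dist_triangle (y + (t * χ y) • v) y q
      have h3 : dist y q ≤ r / 2 := hyb
      linarith
    -- The displacement is a positive multiple of `v`, and the derivative along `v` is negative on
    -- the whole segment.
    obtain ⟨z, hz, hzeq⟩ := domain_mvt (f' := fderiv ℝ g) (fun x hx =>
      (((hg.contDiffAt (hT.mem_nhds (hball hx).1)).differentiableAt
        (by simp)).hasFDerivAt.hasFDerivWithinAt)) (convex_ball q r) hyr hφr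
    have hzr := (hball ((convex_ball q r).segment_subset hyr hφr hz)).2
    rw [hφ, add_sub_cancel_left, map_smul, smul_eq_mul, ← hφ] at hzeq
    have := mul_neg_of_pos_of_neg hpos hzr
    linarith
  refine ⟨φ, Metric.closedBall q (r / 2), ?_, isCompact_closedBall _ _, hφs, hφs', ?_, ?_, ?_⟩
  · exact (Metric.closedBall_subset_ball (by linarith)).trans fun y hy => (hball hy).1
  · intro y hy
    simp [hφ, hzero y hy]
  · intro y
    by_cases hy : χ y = 0
    · left
      simp [hφ, hy]
    · exact Or.inr (hdec y hy)
  · refine hdec q (χ.pos_of_mem_ball ?_).ne'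
    exact Metric.mem_ball_self χ.rOut_pos

end EuclideanPush

section Manifold

variable {n : ℕ} {M : Type*} [TopologicalSpace M]

/-! ### Extending compactly supported maps of a chart domain -/

open Classical in
/-- The self-map of `M` which is `ψ` in the chart `e` and the identity off its source. -/
noncomputable def extendChart (e : OpenPartialHomeomorph M (EuclideanSpace ℝ (Fin n)))
    (ψ : EuclideanSpace ℝ (Fin n) → EuclideanSpace ℝ (Fin n)) (x : M) : M :=
  if x ∈ e.source then e.symm (ψ (e x)) else x

theorem extendChart_of_mem {e : OpenPartialHomeomorph M (EuclideanSpace ℝ (Fin n))}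
    {ψ : EuclideanSpace ℝ (Fin n) → EuclideanSpace ℝ (Fin n)} {x : M} (hx : x ∈ e.source) :
    extendChart e ψ x = e.symm (ψ (e x)) := if_pos hx

theorem extendChart_of_notMem {e : OpenPartialHomeomorph M (EuclideanSpace ℝ (Fin n))}
    {ψ : EuclideanSpace ℝ (Fin n) → EuclideanSpace ℝ (Fin n)} {x : M} (hx : x ∉ e.source) :
    extendChart e ψ x = x := if_neg hx

theorem extendChart_comp {e : OpenPartialHomeomorph M (EuclideanSpace ℝ (Fin n))}
    {ψ ψ' : EuclideanSpace ℝ (Fin n) → EuclideanSpace ℝ (Fin n)}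
    (hψ : MapsTo ψ e.target e.target) (h : ∀ y, ψ' (ψ y) = y) (x : M) :
    extendChart e ψ' (extendChart e ψ x) = x := by
  by_cases hx : x ∈ e.source
  · have h1 := hψ (e.map_source hx)
    rw [extendChart_of_mem hx, extendChart_of_mem (e.map_target h1), e.right_inv h1, h,
      e.left_inv hx]
  · rw [extendChart_of_notMem hx, extendChart_of_notMem hx]

variable [ChartedSpace (EuclideanSpace ℝ (Fin n)) M]

/-- The image of `K` in `M` is compact, hence closed as `M` is Hausdorff. The chart source and the
complement of this image are open and cover `M`; the map is smooth on the first and the identity on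
the second. -/
theorem contMDiff_extendChart [T2Space M] [IsManifold (𝓡 n) ∞ M] (p : M)
    {ψ : EuclideanSpace ℝ (Fin n) → EuclideanSpace ℝ (Fin n)}
    {K : Set (EuclideanSpace ℝ (Fin n))} (hψ : ContDiff ℝ ∞ ψ)
    (hmaps : MapsTo ψ (chartAt (EuclideanSpace ℝ (Fin n)) p).target
      (chartAt (EuclideanSpace ℝ (Fin n)) p).target)
    (hK : IsCompact K) (hKT : K ⊆ (chartAt (EuclideanSpace ℝ (Fin n)) p).target)
    (hid : ∀ y ∉ K, ψ y = y) :
    ContMDiff (𝓡 n) (𝓡 n) ∞ (extendChart (chartAt (EuclideanSpace ℝ (Fin n)) p) ψ) := by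
  set e := chartAt (EuclideanSpace ℝ (Fin n)) p
  intro x
  by_cases hx : x ∈ e.source
  · have h1 : ContMDiffOn (𝓡 n) (𝓡 n) ∞ (fun x => e.symm (ψ (e x))) e.source :=
      (contMDiffOn_chart_symm (I := 𝓡 n) (n := ∞) (x := p)).comp
        (hψ.contMDiff.comp_contMDiffOn (contMDiffOn_chart (I := 𝓡 n) (n := ∞) (x := p)))
        fun y hy => hmaps (e.map_source hy)
    refine (h1.contMDiffAt (e.open_source.mem_nhds hx)).congr_of_eventuallyEq ?_
    filter_upwards [e.open_source.mem_nhds hx] with y hy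
    exact extendChart_of_mem hy
  · have hcl : IsClosed (e.symm '' K) :=
      (hK.image_of_continuousOn (e.continuousOn_symm.mono hKT)).isClosed
    have hxK : x ∉ e.symm '' K := by
      rintro ⟨y, hy, rfl⟩
      exact hx (e.map_target (hKT hy))
    refine contMDiffAt_id.congr_of_eventuallyEq ?_
    filter_upwards [hcl.isOpen_compl.mem_nhds hxK] with y hy
    by_cases hys : y ∈ e.source
    · rw [extendChart_of_mem hys, hid, e.left_inv hys, id]
      exact fun h => hy ⟨e y, h, e.left_inv hys⟩
    · exact extendChart_of_notMem hys

/-- A self-diffeomorphism of Euclidean space, supported in a compact subset of the target of a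
chart, extends to the manifold. -/
theorem exists_diffeomorph_extendChart [T2Space M] [IsManifold (𝓡 n) ∞ M] (p : M)
    (φ : EuclideanSpace ℝ (Fin n) ≃ₜ EuclideanSpace ℝ (Fin n))
    {K : Set (EuclideanSpace ℝ (Fin n))} (hφ : ContDiff ℝ ∞ φ) (hφ' : ContDiff ℝ ∞ φ.symm)
    (hK : IsCompact K) (hKT : K ⊆ (chartAt (EuclideanSpace ℝ (Fin n)) p).target)
    (hid : ∀ y ∉ K, φ y = y) :
    ∃ Φ : M ≃ₘ^∞⟮𝓡 n, 𝓡 n⟯ M,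
      ∀ x, Φ x = extendChart (chartAt (EuclideanSpace ℝ (Fin n)) p) φ x := by
  have hmaps : ∀ ψ : EuclideanSpace ℝ (Fin n) ≃ₜ EuclideanSpace ℝ (Fin n),
      (∀ y ∉ K, ψ y = y) → MapsTo ψ (chartAt (EuclideanSpace ℝ (Fin n)) p).target
        (chartAt (EuclideanSpace ℝ (Fin n)) p).target := by
    intro ψ hψ y hy
    by_contra h
    -- If `ψ y` left the target, it would lie off `K` and be fixed by `ψ`; injectivity then gives `ψ
    -- y = y`.
    have h1 := ψ.injective (hψ (ψ y) fun h' => h (hKT h'))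
    exact h (h1.symm ▸ hy)
  have hid' : ∀ y ∉ K, φ.symm y = y := fun y hy => by
    rw [Homeomorph.symm_apply_eq, hid y hy]
  exact ⟨⟨⟨_, _, extendChart_comp (hmaps φ hid) φ.symm_apply_apply,
      extendChart_comp (hmaps φ.symm hid') φ.apply_symm_apply⟩,
    contMDiff_extendChart p hφ (hmaps φ hid) hK hKT hid,
    contMDiff_extendChart p hφ' (hmaps φ.symm hid') hK hKT hid'⟩, fun _ => rfl⟩

/-! ### Diffeomorphisms decreasing a function -/

theorem fderiv_comp_chart_symm_ne_zero {f : M → ℝ} {p : M} (hp : p ∉ criticalSet n f) :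
    fderiv ℝ (f ∘ (chartAt (EuclideanSpace ℝ (Fin n)) p).symm)
      (chartAt (EuclideanSpace ℝ (Fin n)) p p) ≠ 0 := by
  intro h
  refine hp ?_
  by_cases hd : MDifferentiableAt (𝓡 n) 𝓘(ℝ, ℝ) f p
  · have hw : writtenInExtChartAt (𝓡 n) 𝓘(ℝ, ℝ) p f =
        f ∘ (chartAt (EuclideanSpace ℝ (Fin n)) p).symm := by
      rfl
    have h1 : fderivWithin ℝ (writtenInExtChartAt (𝓡 n) 𝓘(ℝ, ℝ) p f) (range (𝓡 n))
        (extChartAt (𝓡 n) p p) = 0 := by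
      rw [hw]
      simpa [extChartAt, fderivWithin_univ] using h
    exact hd.mfderiv.trans h1
  -- `mfderiv` is 0 by default where `f` is not differentiable, so such points count as critical.
  · exact mfderiv_zero_of_not_mdifferentiableAt hd

theorem exists_diffeomorph_decreasing_at [T2Space M] [IsManifold (𝓡 n) ∞ M] {f : M → ℝ}
    (hf : ContMDiff (𝓡 n) 𝓘(ℝ, ℝ) ∞ f) {p : M} (hp : p ∉ criticalSet n f) :
    ∃ Φ : M ≃ₘ^∞⟮𝓡 n, 𝓡 n⟯ M, (∀ x, Φ x = x ∨ f (Φ x) < f x) ∧ f (Φ p) < f p := by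
  set e := chartAt (EuclideanSpace ℝ (Fin n)) p
  have hps : p ∈ e.source := mem_chart_source _ p
  have hg : ContDiffOn ℝ ∞ (f ∘ e.symm) e.target :=
    (hf.comp_contMDiffOn (contMDiffOn_chart_symm (I := 𝓡 n) (n := ∞) (x := p))).contDiffOn
  obtain ⟨φ, K, hKT, hK, hφ, hφ', hid, hdec, hq⟩ := exists_homeomorph_decreasing e.open_target
    (e.map_source hps) hg (fderiv_comp_chart_symm_ne_zero hp)
  obtain ⟨Φ, hΦ⟩ := exists_diffeomorph_extendChart p φ hφ hφ' hK hKT hid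
  refine ⟨Φ, fun x => ?_, ?_⟩
  · rw [hΦ]
    by_cases hx : x ∈ e.source
    · rw [extendChart_of_mem hx]
      rcases hdec (e x) with h | h
      · left
        rw [h, e.left_inv hx]
      · right
        simpa [e.left_inv hx] using h
    · exact Or.inl (extendChart_of_notMem hx)
  · rw [hΦ, extendChart_of_mem hps]
    simpa [e.left_inv hps] using hq

/-- Strict decrease at a point is an open condition, and "fixed or strictly lowered" survives
composition. Compactness therefore reduces the claim to single points. -/
theorem exists_diffeomorph_decreasing_on [T2Space M] [IsManifold (𝓡 n) ∞ M] {f : M → ℝ}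
    (hf : ContMDiff (𝓡 n) 𝓘(ℝ, ℝ) ∞ f) {C : Set M} (hC : IsCompact C)
    (hcrit : Disjoint C (criticalSet n f)) :
    ∃ Φ : M ≃ₘ^∞⟮𝓡 n, 𝓡 n⟯ M, (∀ x, Φ x = x ∨ f (Φ x) < f x) ∧ ∀ x ∈ C, f (Φ x) < f x := by
  refine hC.induction_on (p := fun s => ∃ Φ : M ≃ₘ^∞⟮𝓡 n, 𝓡 n⟯ M,
    (∀ x, Φ x = x ∨ f (Φ x) < f x) ∧ ∀ x ∈ s, f (Φ x) < f x) ?_ ?_ ?_ ?_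
  · exact ⟨Diffeomorph.refl (𝓡 n) M ∞, fun x => Or.inl rfl, fun x hx => hx.elim⟩
  · rintro s t hst ⟨Φ, h, ht⟩
    exact ⟨Φ, h, fun x hx => ht x (hst hx)⟩
  · rintro s t ⟨Φ, hΦ, hs⟩ ⟨Ψ, hΨ, ht⟩
    have hΨle : ∀ x, f (Ψ x) ≤ f x := fun x =>
      (hΨ x).elim (fun h => (congrArg f h).le) le_of_lt
    refine ⟨Φ.trans Ψ, fun x => ?_, fun x hx => ?_⟩
    · change Ψ (Φ x) = x ∨ f (Ψ (Φ x)) < f x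
      rcases hΦ x with h | h
      · rw [h]
        exact hΨ x
      · exact Or.inr ((hΨle _).trans_lt h)
    · change f (Ψ (Φ x)) < f x
      rcases hΦ x with h | h
      · rcases hx with hx | hx
        · exact (hΨle _).trans_lt (hs x hx)
        · rw [h]
          exact ht x hx
      · exact (hΨle _).trans_lt h
  · intro x hx
    obtain ⟨Φ, hΦ, hlt⟩ := exists_diffeomorph_decreasing_at hf (disjoint_left.1 hcrit hx)
    refine ⟨{y | f (Φ y) < f y}, mem_nhdsWithin_of_mem_nhds ?_, Φ, hΦ, fun y hy => hy⟩
    exact (isOpen_lt (hf.continuous.comp Φ.continuous) hf.continuous).mem_nhds hlt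

/-! ### Open balls -/

theorem IsOpenBall.preimage {U : Opens M} (hU : IsOpenBall (n := n) U)
    (Φ : M ≃ₘ^∞⟮𝓡 n, 𝓡 n⟯ M) :
    IsOpenBall (n := n) (⟨Φ ⁻¹' U, U.isOpen.preimage Φ.continuous⟩ : Opens M) := by
  obtain ⟨ψ⟩ := hU
  set V : Opens M := ⟨Φ ⁻¹' U, U.isOpen.preimage Φ.continuous⟩
  have hV : ∀ x : V, Φ x ∈ U := fun x => x.2
  have hU' : ∀ y : U, Φ.symm y ∈ V := fun y => by
    change Φ (Φ.symm y) ∈ U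
    simp
  let Ψ : V ≃ₘ^∞⟮𝓡 n, 𝓡 n⟯ U :=
    { toFun := fun x => ⟨Φ x, hV x⟩
      invFun := fun y => ⟨Φ.symm y, hU' y⟩
      left_inv := fun x => by simp
      right_inv := fun y => by simp
      contMDiff_toFun := by
        rw [← ContMDiff.subtypeVal_comp_iff]
        exact Φ.contMDiff.comp contMDiff_subtype_val
      contMDiff_invFun := by
        rw [← ContMDiff.subtypeVal_comp_iff]
        exact Φ.symm.contMDiff.comp contMDiff_subtype_val }
  exact ⟨Ψ.trans ψ⟩

/-- A chart is restricted to a metric ball inside its target, which `univBall` identifies smoothly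
with the whole Euclidean space. -/
theorem exists_isOpenBall_mem [IsManifold (𝓡 n) ∞ M] (x : M) :
    ∃ U : Opens M, IsOpenBall (n := n) U ∧ x ∈ U := by
  set e := chartAt (EuclideanSpace ℝ (Fin n)) x
  have hxs : x ∈ e.source := mem_chart_source _ x
  obtain ⟨r, hr, hball⟩ := Metric.isOpen_iff.1 e.open_target (e x) (e.map_source hxs)
  set u := OpenPartialHomeomorph.univBall (e x) r
  have hus : u.source = univ := OpenPartialHomeomorph.univBall_source _ _
  have hut : u.target = Metric.ball (e x) r := OpenPartialHomeomorph.univBall_target _ hr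
  have hmem : ∀ y, u y ∈ Metric.ball (e x) r := fun y => hut ▸ u.map_source (hus ▸ mem_univ y)
  have hes : ContMDiffOn (𝓡 n) (𝓡 n) ∞ e e.source := contMDiffOn_chart
  have het : ContMDiffOn (𝓡 n) (𝓡 n) ∞ e.symm e.target := contMDiffOn_chart_symm
  let U : Opens M := ⟨e.source ∩ e ⁻¹' Metric.ball (e x) r,
    e.isOpen_inter_preimage Metric.isOpen_ball⟩
  refine ⟨U, ⟨?_⟩, hxs, Metric.mem_ball_self hr⟩
  exact
    { toFun := fun y => u.symm (e y)
      invFun := fun y => ⟨e.symm (u y), e.map_target (hball (hmem y)), by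
        rw [mem_preimage, e.right_inv (hball (hmem y))]
        exact hmem y⟩
      left_inv := fun y => Subtype.ext <| by
        change e.symm (u (u.symm (e y))) = y
        rw [u.right_inv (hut ▸ y.2.2), e.left_inv y.2.1]
      right_inv := fun y => by
        change u.symm (e (e.symm (u y))) = y
        rw [e.right_inv (hball (hmem y)), u.left_inv (hus ▸ mem_univ y)]
      contMDiff_toFun := fun y => by
        refine contMDiffAt_subtype_iff (f := fun y : M => u.symm (e y)).2 ?_
        have h1 : ContMDiffOn (𝓡 n) (𝓡 n) ∞ (fun y : M => u.symm (e y))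
            (U : Set M) :=
          (OpenPartialHomeomorph.contDiffOn_univBall_symm.contMDiffOn).comp
            (hes.mono inter_subset_left) fun z hz => hz.2
        exact h1.contMDiffAt (U.isOpen.mem_nhds y.2)
      contMDiff_invFun := by
        rw [← ContMDiff.subtypeVal_comp_iff]
        exact het.comp_contMDiff OpenPartialHomeomorph.contDiff_univBall.contMDiff
          fun y => hball (hmem y) }

/-! ### The ball number -/

theorem CoveredByBalls.mono {A B : Set M} {k : ℕ} (h : CoveredByBalls n B k) (hAB : A ⊆ B) :
    CoveredByBalls n A k := by
  obtain ⟨U, hU, hB⟩ := h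
  exact ⟨U, hU, hAB.trans hB⟩

theorem CoveredByBalls.union {A B : Set M} {k l : ℕ} (hA : CoveredByBalls n A k)
    (hB : CoveredByBalls n B l) : CoveredByBalls n (A ∪ B) (k + l) := by
  obtain ⟨U, hU, hAU⟩ := hA
  obtain ⟨V, hV, hBV⟩ := hB
  refine ⟨Fin.append U V, fun i => ?_, ?_⟩
  · refine Fin.addCases (fun i => ?_) (fun i => ?_) i
    · simpa using hU i
    · simpa using hV i
  · rintro x (hx | hx)
    · obtain ⟨i, hi⟩ := mem_iUnion.1 (hAU hx)
      exact mem_iUnion.2 ⟨Fin.castAdd l i, by simpa using hi⟩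
    · obtain ⟨i, hi⟩ := mem_iUnion.1 (hBV hx)
      exact mem_iUnion.2 ⟨Fin.natAdd k i, by simpa using hi⟩

theorem CoveredByBalls.preimage {A : Set M} {k : ℕ} (hA : CoveredByBalls n A k)
    (Φ : M ≃ₘ^∞⟮𝓡 n, 𝓡 n⟯ M) : CoveredByBalls n (Φ ⁻¹' A) k := by
  obtain ⟨U, hU, hAU⟩ := hA
  refine ⟨fun i => ⟨Φ ⁻¹' U i, (U i).isOpen.preimage Φ.continuous⟩,
    fun i => (hU i).preimage Φ, fun x hx => ?_⟩
  obtain ⟨i, hi⟩ := mem_iUnion.1 (hAU hx)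
  exact mem_iUnion.2 ⟨i, hi⟩

theorem CoveredByBalls.exists_isOpen {A : Set M} {k : ℕ} (hA : CoveredByBalls n A k) :
    ∃ W : Set M, IsOpen W ∧ A ⊆ W ∧ CoveredByBalls n W k := by
  obtain ⟨U, hU, hAU⟩ := hA
  exact ⟨_, isOpen_iUnion fun i => (U i).isOpen, hAU, U, hU, Subset.rfl⟩

theorem CoveredByBalls.ballNumber_le {A : Set M} {k : ℕ} (hA : CoveredByBalls n A k) :
    ballNumber n A ≤ k := iInf₂_le k hA

theorem exists_coveredByBalls_ballNumber {A : Set M} (h : ballNumber n A ≠ ⊤) :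
    ∃ k : ℕ, CoveredByBalls n A k ∧ ballNumber n A = k := by
  classical
  have hex : ∃ k, CoveredByBalls n A k := by
    by_contra! hno
    exact h (by simp [ballNumber, hno])
  refine ⟨Nat.find hex, Nat.find_spec hex, le_antisymm (Nat.find_spec hex).ballNumber_le ?_⟩
  exact le_iInf₂ fun m hm => Nat.cast_le.2 (Nat.find_min' hex hm)

theorem ballNumber_le_of_forall {A B : Set M}
    (h : ∀ k, CoveredByBalls n B k → CoveredByBalls n A k) : ballNumber n A ≤ ballNumber n B :=
  le_iInf₂ fun k hk => (h k hk).ballNumber_le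

theorem ballNumber_mono {A B : Set M} (hAB : A ⊆ B) : ballNumber n A ≤ ballNumber n B :=
  ballNumber_le_of_forall fun _ hk => hk.mono hAB

theorem ballNumber_preimage_le (A : Set M) (Φ : M ≃ₘ^∞⟮𝓡 n, 𝓡 n⟯ M) :
    ballNumber n (Φ ⁻¹' A) ≤ ballNumber n A :=
  ballNumber_le_of_forall fun _ hk => hk.preimage Φ

theorem ballNumber_empty : ballNumber n (∅ : Set M) = 0 := by
  have h : CoveredByBalls n (∅ : Set M) 0 := ⟨Fin.elim0, fun i => i.elim0, empty_subset _⟩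
  simpa using h.ballNumber_le

theorem ballNumber_union_le (A B : Set M) :
    ballNumber n (A ∪ B) ≤ ballNumber n A + ballNumber n B := by
  by_cases hA : ballNumber n A = ⊤
  · simp [hA]
  by_cases hB : ballNumber n B = ⊤
  · simp [hB]
  obtain ⟨k, hk, hk'⟩ := exists_coveredByBalls_ballNumber hA
  obtain ⟨l, hl, hl'⟩ := exists_coveredByBalls_ballNumber hB
  rw [hk', hl']
  exact_mod_cast (hk.union hl).ballNumber_le

theorem IsOpenBall.ballNumber_le_one {U : Opens M} (hU : IsOpenBall (n := n) U) :
    ballNumber n (U : Set M) ≤ 1 := by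
  have h : CoveredByBalls n (U : Set M) 1 :=
    ⟨fun _ => U, fun _ => hU, fun x hx => mem_iUnion.2 ⟨0, hx⟩⟩
  simpa using h.ballNumber_le

theorem ballNumber_le_encard [IsManifold (𝓡 n) ∞ M] (A : Set M) :
    ballNumber n A ≤ A.encard := by
  by_cases hA : A.Finite
  · induction A, hA using Set.Finite.induction_on with
    | empty => simp [ballNumber_empty]
    | @insert a s ha _ ih =>
      obtain ⟨U, hU, haU⟩ := exists_isOpenBall_mem (n := n) a
      rw [encard_insert_of_notMem ha, insert_eq, add_comm]
      refine (ballNumber_union_le _ _).trans (add_le_add ?_ ih)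
      exact (ballNumber_mono (singleton_subset_iff.2 haU)).trans hU.ballNumber_le_one
  · rw [Set.Infinite.encard_eq hA]
    exact le_top

theorem ballNumber_ne_top [CompactSpace M] [IsManifold (𝓡 n) ∞ M] (A : Set M) :
    ballNumber n A ≠ ⊤ := by
  refine ne_top_of_le_ne_top ?_ (ballNumber_mono (subset_univ A))
  refine isCompact_univ.induction_on (p := fun s => ballNumber n s ≠ ⊤) ?_ ?_ ?_ ?_
  · simp [ballNumber_empty]
  · exact fun s t hst ht => ne_top_of_le_ne_top ht (ballNumber_mono hst)
  · exact fun s t hs ht =>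
      ne_top_of_le_ne_top (WithTop.add_ne_top.2 ⟨hs, ht⟩) (ballNumber_union_le s t)
  · intro x _
    obtain ⟨U, hU, hxU⟩ := exists_isOpenBall_mem (n := n) x
    exact ⟨U, mem_nhdsWithin_of_mem_nhds (U.isOpen.mem_nhds hxU),
      ne_top_of_le_ne_top ENat.one_ne_top hU.ballNumber_le_one⟩

/-! ### Sublevel sets -/

/-- Off an open union of balls covering `sublevel f c`, the function attains a minimum exceeding
`c`; this minimum serves as `c'`. -/
theorem exists_forall_lt_ballNumber_sublevel_le [CompactSpace M] [IsManifold (𝓡 n) ∞ M]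
    {f : M → ℝ} (hf : Continuous f) (c : ℝ) :
    ∃ c' > c, ∀ d < c', ballNumber n (sublevel f d) ≤ ballNumber n (sublevel f c) := by
  obtain ⟨k, hk, hk'⟩ := exists_coveredByBalls_ballNumber (ballNumber_ne_top (n := n) (sublevel f c))
  obtain ⟨W, hW, hsub, hWk⟩ := hk.exists_isOpen
  rw [hk']
  suffices h : ∃ c' > c, ∀ d < c', sublevel f d ⊆ W by
    obtain ⟨c', hc', h⟩ := h
    exact ⟨c', hc', fun d hd => (hWk.mono (h d hd)).ballNumber_le⟩
  rcases Wᶜ.eq_empty_or_nonempty with he | hne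
  · rw [compl_empty_iff] at he
    exact ⟨c + 1, by linarith, fun d _ => he ▸ subset_univ _⟩
  · obtain ⟨x, hx, hmin⟩ := hW.isClosed_compl.isCompact.exists_isMinOn hne hf.continuousOn
    refine ⟨f x, ?_, fun d hd y hy => ?_⟩
    · by_contra! h
      exact hx (hsub h)
    · by_contra hyW
      have h1 : f x ≤ f y := hmin hyW
      have h2 : f y ≤ d := hy
      linarith

/-- Bounds the jump at `d` by the critical points there. All `c' > c` are allowed because the
supremum argument supplies only some level close to `d`. -/
theorem exists_forall_gt_ballNumber_sublevel_le [T2Space M] [CompactSpace M]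
    [IsManifold (𝓡 n) ∞ M] {f : M → ℝ} (hf : ContMDiff (𝓡 n) 𝓘(ℝ, ℝ) ∞ f) (d : ℝ) :
    ∃ c < d, ∀ c' > c, ballNumber n (sublevel f d) ≤
      ballNumber n (criticalSet n f ∩ f ⁻¹' {d}) + ballNumber n (sublevel f c') := by
  have hcont : Continuous f := hf.continuous
  obtain ⟨k, hk, hk'⟩ := exists_coveredByBalls_ballNumber
    (ballNumber_ne_top (n := n) (criticalSet n f ∩ f ⁻¹' {d}))
  obtain ⟨W, hW, hsub, hWk⟩ := hk.exists_isOpen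
  have hC : IsCompact (f ⁻¹' {d} \ W) :=
    ((isClosed_singleton.preimage hcont).sdiff hW).isCompact
  obtain ⟨Φ, hΦ, hΦC⟩ := exists_diffeomorph_decreasing_on hf hC
    (disjoint_left.2 fun x hx hxc => hx.2 (hsub ⟨hxc, hx.1⟩))
  suffices h : ∃ c < d, ∀ x ∈ sublevel f d \ W, f (Φ x) ≤ c by
    obtain ⟨c, hc, h⟩ := h
    refine ⟨c, hc, fun c' hc' => ?_⟩
    have h1 : sublevel f d ⊆ W ∪ Φ ⁻¹' sublevel f c' := by
      intro x hx
      by_cases hxW : x ∈ W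
      · exact Or.inl hxW
      · exact Or.inr ((h x ⟨hx, hxW⟩).trans hc'.le)
    rw [hk']
    exact (ballNumber_mono h1).trans ((ballNumber_union_le _ _).trans
      (add_le_add hWk.ballNumber_le (ballNumber_preimage_le _ Φ)))
  rcases (sublevel f d \ W).eq_empty_or_nonempty with he | hne
  · exact ⟨d - 1, by linarith, by simp [he]⟩
  · have hS : IsCompact (sublevel f d \ W) :=
      ((isClosed_le hcont continuous_const).sdiff hW).isCompact
    obtain ⟨x, hx, hmax⟩ := hS.exists_isMaxOn hne (hcont.comp Φ.continuous).continuousOn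
    refine ⟨f (Φ x), ?_, fun y hy => hmax hy⟩
    -- Points already below `d` are not raised, and points on the level `d` outside `W` are strictly
    -- lowered, so the maximum is below `d`.
    have hxd : f x ≤ d := hx.1
    rcases hxd.lt_or_eq with h | h
    · rcases hΦ x with h' | h'
      · rwa [h']
      · exact h'.trans h
    · exact (hΦC x ⟨h, hx.2⟩).trans_eq h

/-- The Lusternik–Schnirelmann inequality, with finitely many levels on the right-hand side. -/
theorem exists_finset_ballNumber_sublevel_le [T2Space M] [CompactSpace M]
    [IsManifold (𝓡 n) ∞ M] {f : M → ℝ} (hf : ContMDiff (𝓡 n) 𝓘(ℝ, ℝ) ∞ f) {a b : ℝ}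
    (hab : a ≤ b) :
    ∃ F : Finset ℝ, (F : Set ℝ) ⊆ Ioc a b ∧ ballNumber n (sublevel f b) ≤
      ∑ d ∈ F, ballNumber n (criticalSet n f ∩ f ⁻¹' {d}) + ballNumber n (sublevel f a) := by
  set T : Set ℝ := {c ∈ Icc a b | ∃ F : Finset ℝ, (F : Set ℝ) ⊆ Ioc a c ∧
    ballNumber n (sublevel f c) ≤ ∑ d ∈ F, ballNumber n (criticalSet n f ∩ f ⁻¹' {d}) +
      ballNumber n (sublevel f a)}
  have haT : a ∈ T := ⟨left_mem_Icc.2 hab, ∅, by simp, by simp⟩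
  have hbdd : BddAbove T := ⟨b, fun c hc => hc.1.2⟩
  set s := sSup T with hs
  have has : a ≤ s := le_csSup hbdd haT
  have hsb : s ≤ b := csSup_le ⟨a, haT⟩ fun c hc => hc.1.2
  -- The supremum is attained: the jump bound at `s` extends the estimate from a slightly lower
  -- level of `T`, at the price of adding `s` to `F`.
  have hsT : s ∈ T := by
    obtain ⟨c, hc, hle⟩ := exists_forall_gt_ballNumber_sublevel_le hf s
    obtain ⟨c', hc'T, hc'⟩ := exists_lt_of_lt_csSup ⟨a, haT⟩ hc
    rcases (le_csSup hbdd hc'T).lt_or_eq with hlt | heq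
    · obtain ⟨hmem, F, hF, hFle⟩ := hc'T
      have hsF : s ∉ F := fun h => (hF h).2.not_gt hlt
      refine ⟨⟨has, hsb⟩, insert s F, ?_, ?_⟩
      · rw [Finset.coe_insert]
        refine insert_subset ⟨hmem.1.trans_lt hlt, le_rfl⟩ (hF.trans ?_)
        exact Ioc_subset_Ioc_right hlt.le
      · rw [Finset.sum_insert hsF, add_assoc]
        exact (hle c' hc').trans (by gcongr)
    · rwa [hs, ← heq]
  obtain ⟨-, F, hF, hFle⟩ := hsT
  rcases hsb.lt_or_eq with hlt | heq
  -- If `s < b`, the same `F` works slightly above `s`, since there is no jump to the right.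
  · exfalso
    obtain ⟨c', hc', hle⟩ := exists_forall_lt_ballNumber_sublevel_le (n := n) hf.continuous s
    obtain ⟨d, hsd, hd⟩ := exists_between (lt_min hc' hlt)
    have hdT : d ∈ T :=
      ⟨⟨has.trans hsd.le, (hd.trans_le (min_le_right _ _)).le⟩, F,
        hF.trans (Ioc_subset_Ioc_right hsd.le),
        (hle d (hd.trans_le (min_le_left _ _))).trans hFle⟩
    exact (le_csSup hbdd hdT).not_gt hsd
  · exact ⟨F, heq ▸ hF, heq ▸ hFle⟩

theorem ballNumber_univ_le_encard_criticalSet [T2Space M] [CompactSpace M]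
    [IsManifold (𝓡 n) ∞ M] {f : M → ℝ} (hf : ContMDiff (𝓡 n) 𝓘(ℝ, ℝ) ∞ f) :
    ballNumber n (univ : Set M) ≤ (criticalSet n f).encard := by
  obtain ⟨C, hC⟩ := (isCompact_univ (X := M)).exists_bound_of_continuousOn
    hf.continuous.continuousOn
  have hC' : ∀ x, |f x| ≤ C := fun x => hC x (mem_univ x)
  -- For empty `M` the bound `C` may be negative, hence `|C|`; subtracting 1 makes the lower
  -- sublevel set empty.
  obtain ⟨F, -, hF⟩ := exists_finset_ballNumber_sublevel_le hf
    (show -|C| - 1 ≤ |C| by linarith [abs_nonneg C])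
  have h1 : sublevel f (-|C| - 1) = ∅ := by
    refine eq_empty_of_forall_notMem fun x hx => ?_
    have h2 : f x ≤ -|C| - 1 := hx
    linarith [hC' x, neg_abs_le (f x), le_abs_self C]
  have h2 : sublevel f |C| = univ :=
    eq_univ_of_forall fun x => (le_abs_self _).trans ((hC' x).trans (le_abs_self C))
  rw [h1, h2, ballNumber_empty, add_zero] at hF
  -- One ball per critical point suffices, and distinct levels are disjoint, so their cardinalities
  -- add.
  have h3 : ∀ F : Finset ℝ, ∑ d ∈ F, ballNumber n (criticalSet n f ∩ f ⁻¹' {d}) ≤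
      (criticalSet n f ∩ f ⁻¹' F).encard := by
    intro F
    induction F using Finset.induction_on with
    | empty => simp
    | insert d F hd ih =>
      rw [Finset.sum_insert hd, Finset.coe_insert, insert_eq, preimage_union, inter_union_distrib_left,
        encard_union_eq]
      · exact add_le_add (ballNumber_le_encard _) ih
      · refine disjoint_left.2 fun x hx hx' => hd ?_
        have hxd : f x = d := hx.2
        exact hxd ▸ hx'.2
  exact hF.trans ((h3 F).trans (encard_le_encard inter_subset_left))

end Manifold

/-- A sum in `ℕ∞` is the supremum of its finite partial sums, and `F` gives one of these. -/
theorem ENat.sum_le_tsum_subtype {ι : Type*} {s : Set ι} (g : ι → ℕ∞) (F : Finset ι)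
    (hF : (F : Set ι) ⊆ s) : ∑ i ∈ F, g i ≤ ∑' i : s, g i := by
  classical
  have h := hasSum_of_isLUB _ (isLUB_iSup (f := fun t : Finset s => ∑ i ∈ t, g i))
  rw [h.tsum_eq]
  refine le_trans (le_of_eq ?_) (le_iSup _ (F.subtype (· ∈ s)))
  exact (Finset.sum_subtype_of_mem g fun x hx => hF hx).symm

theorem corollary8p5 (n : ℕ) (M : Type*) [TopologicalSpace M] [T2Space M] [CompactSpace M]
    [ChartedSpace (EuclideanSpace ℝ (Fin n)) M] [IsManifold (𝓡 n) ∞ M] :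
    (∀ A : Set M, ballNumber n A ≠ ⊤) ∧
    (∀ f : M → ℝ, ContMDiff (𝓡 n) 𝓘(ℝ, ℝ) ∞ f → ∀ a b : ℝ, a < b →
      ballNumber n (sublevel f b) - ballNumber n (sublevel f a) ≤
        ∑' d : Ioc a b, ballNumber n (criticalSet n f ∩ f ⁻¹' {(d : ℝ)})) ∧
    ballNumber n (univ : Set M) ≤ critNumber n M := by
  refine ⟨ballNumber_ne_top, fun f hf a b hab => ?_, ?_⟩
  · obtain ⟨F, hF, hle⟩ := exists_finset_ballNumber_sublevel_le hf hab.le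
    -- The truncated subtraction loses nothing: ball numbers are finite and monotone.
    exact tsub_le_iff_right.2 (hle.trans (add_le_add
      (ENat.sum_le_tsum_subtype (fun d => ballNumber n (criticalSet n f ∩ f ⁻¹' {d})) F hF) le_rfl))
  · exact le_iInf₂ fun f hf => ballNumber_univ_le_encard_criticalSet hf
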